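/- Consider the following zero-sum game $\mathscr{G}^{\mathrm{special}}$ with finite horizon $T$. For each $t$ the state space $\mathcal X_t$, the action spaces $\mathcal U_t^1,\mathcal U_t^2$ of the two players and the observation space $\mathcal Y_t^2$ are finite sets, the action spaces being non-empty. The state evolves as $X_{t+1}=f_t(X_t,U_t^1,U_t^2,W_t^s)$. At each time $t$ player 1 observes the state $X_t$ and both players see $Y_t^2=h_t^2(X_t,U_{t-1}^1,U_{t-1}^2,W_t^2)$ (where no actions appear for $t=1$). The primitive random variables $X_1$, $W_t^s$, $W_t^2$ take finitely many values, are mutually independent and have given laws. When choosing the action at time $t$, player 1 knows $I_t^1=\{X_{1:t},Y_{1:t}^2,U_{1:t-1}^1,U_{1:t-1}^2\}$ and player 2 knows $I_t^2=\{Y_{1:t}^2,U_{1:t-1}^2\}$. A (behavioral) strategy of player $i$ is a family $g^i=(g^i_1,\dots,g^i_T)$ of maps $g^i_t$ from the realizations of $I_t^i$ to probability distributions on $\mathcal U_t^i$; the action $U_t^i$ is drawn from $g_t^i(I_t^i)$, with randomizations that are independent across players and times and of the primitive random variables. For given real cost functions $c_t$, let $$J(g^1,g^2)=\mathbb E^{(g^1,g^2)}\Big[\sum_{t=1}^T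 c_t(X_t,U_t^1,U_t^2)\Big],$$ which player 1 wants to minimize and player 2 wants to maximize. Then there is a Nash equilibrium in behavioral strategies, i.e. a profile $(g^{1*},g^{2*})$ with $$J(g^{1*},g^2)\le J(g^{1*},g^{2*})\le J(g^1,g^{2*})\qquad\text{for all strategies } g^1,g^2 ,$$ and consequently the game has a value: $$\inf_{g^1}\sup_{g^2}J(g^1,g^2)=\sup_{g^2}\inf_{g^1}J(g^1,g^2)=J(g^{1*},g^{2*}).$$ -/

import Mathlib

universe u

/-- Data of a finite-horizon zero-sum stochastic game in which player 1 has complete information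
and player 2 has partial information.  Stages are numbered `0, …, T - 1`; the data at indices
that the horizon does not reach are never used.  The primitive random variables (initial state,
state noises, observation noises) take values in finite sets and are given by their laws; they are
mutually independent (the law of the play below draws them independently). -/
structure OneSidedGame where
  /-- the horizon (number of stages) -/
  T : ℕ
  /-- state spaces -/
  X : ℕ → Type u
  /-- observation spaces of player 2 -/
  Y : ℕ → Type u
  /-- action spaces of player 1 -/
  U₁ : ℕ → Type u
  /-- action spaces of player 2 -/
  U₂ : ℕ → Type u
  /-- value spaces of the system noises -/
  Ws : ℕ → Type u
  /-- value spaces of the observation noises -/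
  Wo : ℕ → Type u
  fintypeX : ∀ t, Fintype (X t)
  fintypeY : ∀ t, Fintype (Y t)
  fintypeU₁ : ∀ t, Fintype (U₁ t)
  fintypeU₂ : ∀ t, Fintype (U₂ t)
  fintypeWs : ∀ t, Fintype (Ws t)
  fintypeWo : ∀ t, Fintype (Wo t)
  nonemptyU₁ : ∀ t, Nonempty (U₁ t)
  nonemptyU₂ : ∀ t, Nonempty (U₂ t)
  /-- law of the initial state -/
  initLaw : PMF (X 0)
  /-- laws of the system noises -/
  sysNoise : ∀ t, PMF (Ws t)
  /-- laws of the observation noises -/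
  obsNoise : ∀ t, PMF (Wo t)
  /-- state evolution `X_{t+1} = f_t (X_t, U¹_t, U²_t, Wˢ_t)` -/
  f : ∀ t, X t → U₁ t → U₂ t → Ws t → X (t + 1)
  /-- first observation of player 2 (no action precedes it) -/
  hInit : X 0 → Wo 0 → Y 0
  /-- later observations of player 2, `Y_{t+1} = h_{t+1} (X_{t+1}, U¹_t, U²_t, W_{t+1})` -/
  h : ∀ t, X (t + 1) → U₁ t → U₂ t → Wo (t + 1) → Y (t + 1)
  /-- stage costs -/
  c : ∀ t, X t → U₁ t → U₂ t → ℝ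

namespace OneSidedGame

attribute [instance] fintypeX fintypeY fintypeU₁ fintypeU₂ fintypeWs fintypeWo
  nonemptyU₁ nonemptyU₂

/-- Records of the stages before `t`: all states, observations and actions at stages `s < t`. -/
def Past (G : OneSidedGame.{u}) : ℕ → Type u
  | 0 => PUnit
  | t + 1 => Past G t × G.X t × G.Y t × G.U₁ t × G.U₂ t

/-- The part of the record of the stages before `t` that player 2 knows: the observations and
player 2's own actions at stages `s < t`. -/
def Past₂ (G : OneSidedGame.{u}) : ℕ → Type u
  | 0 => PUnit
  | t + 1 => Past₂ G t × G.Y t × G.U₂ t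

/-- A record of finitely many stages has finitely many values. -/
noncomputable instance fintypePast (G : OneSidedGame.{u}) : ∀ t, Fintype (G.Past t)
  | 0 => inferInstanceAs (Fintype PUnit)
  | t + 1 =>
    letI := fintypePast G t
    inferInstanceAs (Fintype (G.Past t × G.X t × G.Y t × G.U₁ t × G.U₂ t))

/-- A record of finitely many stages of player 2 has finitely many values. -/
noncomputable instance fintypePast₂ (G : OneSidedGame.{u}) : ∀ t, Fintype (G.Past₂ t)
  | 0 => inferInstanceAs (Fintype PUnit)
  | t + 1 =>
    letI := fintypePast₂ G t
    inferInstanceAs (Fintype (G.Past₂ t × G.Y t × G.U₂ t))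

/-- What player 2 knows of a record. -/
def restrict (G : OneSidedGame.{u}) : ∀ t, G.Past t → G.Past₂ t
  | 0, _ => PUnit.unit
  | t + 1, (p, _, y, _, u₂) => (restrict G t p, y, u₂)

/-- Information of player 1 when acting at stage `t`: all states and observations up to and
including stage `t`, and all actions of both players before stage `t`. -/
abbrev Info₁ (G : OneSidedGame.{u}) (t : ℕ) : Type u := G.Past t × G.X t × G.Y t

/-- Information of player 2 when acting at stage `t`: the observations up to and including
stage `t`, and player 2's own actions before stage `t`. -/
abbrev Info₂ (G : OneSidedGame.{u}) (t : ℕ) : Type u := G.Past₂ t × G.Y t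

/-- Behavioral strategies of player 1. -/
abbrev Strategy₁ (G : OneSidedGame.{u}) : Type u := ∀ t : Fin G.T, G.Info₁ t → PMF (G.U₁ t)

/-- Behavioral strategies of player 2. -/
abbrev Strategy₂ (G : OneSidedGame.{u}) : Type u := ∀ t : Fin G.T, G.Info₂ t → PMF (G.U₂ t)

/-- Joint law of the state and of player 2's observation at stage `t`, given the record of the
earlier stages. -/
noncomputable def stateObs (G : OneSidedGame.{u}) : ∀ t, G.Past t → PMF (G.X t × G.Y t)
  | 0, _ => G.initLaw.bind fun x => (G.obsNoise 0).map fun w => (x, G.hInit x w)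
  | t + 1, (_, x, _, u₁, u₂) =>
    (G.sysNoise t).bind fun ws => (G.obsNoise (t + 1)).map fun wo =>
      (G.f t x u₁ u₂ ws, G.h t (G.f t x u₁ u₂ ws) u₁ u₂ wo)

/-- Law of the record of the first `t` stages under a strategy profile.  At each stage the state
and the observation are generated, and then each player independently draws an action from the
distribution that the player's control law assigns to the player's information. -/
noncomputable def law (G : OneSidedGame.{u}) (g₁ : G.Strategy₁) (g₂ : G.Strategy₂) :
    ∀ t, t ≤ G.T → PMF (G.Past t)
  | 0, _ => PMF.pure PUnit.unit
  | t + 1, ht =>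
    (law G g₁ g₂ t (Nat.le_of_succ_le ht)).bind fun p =>
      (G.stateObs t p).bind fun s =>
        (g₁ ⟨t, ht⟩ (p, s.1, s.2)).bind fun u₁ =>
          (g₂ ⟨t, ht⟩ (G.restrict t p, s.2)).bind fun u₂ =>
            PMF.pure ((p, s.1, s.2, u₁, u₂) : G.Past (t + 1))

/-- Total cost of the stages before `t` along a record. -/
def totalCost (G : OneSidedGame.{u}) : ∀ t, G.Past t → ℝ
  | 0, _ => 0
  | t + 1, (p, x, _, u₁, u₂) => totalCost G t p + G.c t x u₁ u₂

/-- Total expected cost of a strategy profile. -/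
noncomputable def J (G : OneSidedGame.{u}) (g₁ : G.Strategy₁) (g₂ : G.Strategy₂) : ℝ :=
  ∑ p : G.Past G.T, (G.law g₁ g₂ G.T le_rfl p).toReal * G.totalCost G.T p

/-- Nash equilibrium: player 1 minimizes and player 2 maximizes the total expected cost. -/
def IsNash (G : OneSidedGame.{u}) (g₁ : G.Strategy₁) (g₂ : G.Strategy₂) : Prop :=
  (∀ g₂' : G.Strategy₂, G.J g₁ g₂' ≤ G.J g₁ g₂) ∧ (∀ g₁' : G.Strategy₁, G.J g₁ g₂ ≤ G.J g₁' g₂)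

/-- Upper value; the infimum and supremum are taken in the extended reals. -/
noncomputable def upperValue (G : OneSidedGame.{u}) : EReal :=
  ⨅ g₁ : G.Strategy₁, ⨆ g₂ : G.Strategy₂, (G.J g₁ g₂ : EReal)

/-- Lower value; the infimum and supremum are taken in the extended reals. -/
noncomputable def lowerValue (G : OneSidedGame.{u}) : EReal :=
  ⨆ g₂ : G.Strategy₂, ⨅ g₁ : G.Strategy₁, (G.J g₁ g₂ : EReal)

end OneSidedGame

-- The cost is not convex or concave in behavioral strategies, since a player's probabilities at
-- different stages multiply. Both players have perfect recall, so one can use realization plans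
-- instead: the product of a player's own probabilities along a history becomes the variable. Plans
-- form a compact convex set cut out by linear equations, and they yield the same weights as
-- behavioral strategies (`exists_plan_of_behavior`, `exists_behavior_of_plan`). The law of play
-- factors into chance and one weight per player (`law_toReal`), so the cost is bilinear in the
-- weights. Sion's theorem gives a saddle point in plans, which translates back to strategies.

section RealizationPlan

/-! ### Realization plans

A player with perfect recall is described by the histories `R t`, the information sets `K t` and
the actions `A t`; `past` is the history before an information set, while `info` and `act` read
the last information set and the last action off a history. -/

variable {R K A : ℕ → Type*} (past : ∀ t, K t → R t) (info : ∀ t, R (t + 1) → K t)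
  (act : ∀ t, R (t + 1) → A t)

/-- The weight that a realization plan gives to a history. -/
def planWeight (s : ∀ t, K t → A t → ℝ) : ∀ t, R t → ℝ
  | 0, _ => 1
  | t + 1, q => s t (info t q) (act t q)

/-- The probability that a behavioral strategy contributes to a history. -/
noncomputable def behaviorWeight (g : ∀ t, K t → PMF (A t)) : ∀ t, R t → ℝ
  | 0, _ => 1
  | t + 1, q => behaviorWeight g t (past t (info t q)) * (g t (info t q) (act t q)).toReal

/-- The realization plans. -/
def planSet [∀ t, Fintype (A t)] : Set (∀ t, K t → A t → ℝ) :=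
  {s | (∀ t k u, 0 ≤ s t k u) ∧ ∀ t k, ∑ u, s t k u = planWeight info act s t (past t k)}

lemma PMF.sum_toReal_eq_one {α : Type*} [Fintype α] (p : PMF α) : ∑ a, (p a).toReal = 1 := by
  rw [← ENNReal.toReal_sum fun a _ => p.apply_ne_top a, ← tsum_fintype (L := .unconditional _),
    p.tsum_coe, ENNReal.toReal_one]

lemma behaviorWeight_nonneg (g : ∀ t, K t → PMF (A t)) (t : ℕ) (q : R t) :
    0 ≤ behaviorWeight past info act g t q := by
  induction t with
  | zero => exact zero_le_one
  | succ t ih => exact mul_nonneg (ih _) ENNReal.toReal_nonneg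

lemma planWeight_nonneg {s : ∀ t, K t → A t → ℝ} (hs : ∀ t k u, 0 ≤ s t k u) (t : ℕ) (q : R t) :
    0 ≤ planWeight info act s t q := by
  cases t with
  | zero => exact zero_le_one
  | succ t => exact hs _ _ _

/-- The weight is affine, not linear, in the plan: the empty history always has weight 1, hence the
need for `a + b = 1`. -/
lemma planWeight_convexComb (s s' : ∀ t, K t → A t → ℝ) {a b : ℝ} (hab : a + b = 1) (t : ℕ)
    (q : R t) :
    planWeight info act (a • s + b • s') t q =
      a * planWeight info act s t q + b * planWeight info act s' t q := by
  cases t with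
  | zero => simpa [planWeight] using hab.symm
  | succ t => simp [planWeight]

lemma continuous_planWeight (t : ℕ) (q : R t) :
    Continuous fun s : ∀ t, K t → A t → ℝ => planWeight info act s t q := by
  cases t with
  | zero => exact continuous_const
  | succ t => simp only [planWeight]; fun_prop

/-- A behavioral strategy induces a realization plan with the same weights. -/
lemma exists_plan_of_behavior [∀ t, Fintype (A t)] (g : ∀ t, K t → PMF (A t)) :
    ∃ s ∈ planSet past info act, planWeight info act s = behaviorWeight past info act g := by
  set s : ∀ t, K t → A t → ℝ :=
    fun t k u => behaviorWeight past info act g t (past t k) * (g t k u).toReal with hs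
  have hw : planWeight info act s = behaviorWeight past info act g := by
    funext t q
    cases t <;> rfl
  refine ⟨s, ⟨fun t k u => mul_nonneg (behaviorWeight_nonneg past info act g _ _)
    ENNReal.toReal_nonneg, fun t k => ?_⟩, hw⟩
  rw [hw, hs]
  simp only [← Finset.mul_sum, PMF.sum_toReal_eq_one, mul_one]

/-- A realization plan is induced by a behavioral strategy. -/
lemma exists_behavior_of_plan [∀ t, Fintype (A t)] [∀ t, Nonempty (A t)]
    {s : ∀ t, K t → A t → ℝ} (hs : s ∈ planSet past info act) :
    ∃ g : ∀ t, K t → PMF (A t), behaviorWeight past info act g = planWeight info act s := by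
  have key : ∀ t k, ∃ p : PMF (A t), ∀ u,
      planWeight info act s t (past t k) * (p u).toReal = s t k u := by
    intro t k
    rcases (planWeight_nonneg info act hs.1 t (past t k)).eq_or_lt with h0 | hpos
    -- The player's own past moves give this information set weight 0; the plan vanishes there, so
    -- any distribution will do.
    · refine ⟨PMF.pure (Classical.arbitrary _), fun u => ?_⟩
      have hz := (Finset.sum_eq_zero_iff_of_nonneg fun u _ => hs.1 t k u).1
        ((hs.2 t k).trans h0.symm) u (Finset.mem_univ u)
      rw [hz, ← h0, zero_mul]
    -- Otherwise the behavioral strategy is the conditional probability of the action given the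
    -- information set.
    · refine ⟨PMF.ofFintype
        (fun u => ENNReal.ofReal (s t k u / planWeight info act s t (past t k))) ?_, fun u => ?_⟩
      · rw [← ENNReal.ofReal_sum_of_nonneg fun u _ => div_nonneg (hs.1 t k u) hpos.le,
          ← Finset.sum_div, hs.2, div_self hpos.ne', ENNReal.ofReal_one]
      · rw [PMF.ofFintype_apply, ENNReal.toReal_ofReal (div_nonneg (hs.1 t k u) hpos.le),
          mul_div_cancel₀ _ hpos.ne']
  choose g hg using key
  refine ⟨g, ?_⟩
  funext t q
  induction t with
  | zero => rfl
  | succ t ih => rw [behaviorWeight, ih, hg, planWeight]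

lemma convex_planSet [∀ t, Fintype (A t)] : Convex ℝ (planSet past info act) := by
  intro s hs s' hs' a b ha hb hab
  refine ⟨fun t k u => add_nonneg (mul_nonneg ha (hs.1 t k u)) (mul_nonneg hb (hs'.1 t k u)),
    fun t k => ?_⟩
  rw [planWeight_convexComb info act s s' hab, ← hs.2, ← hs'.2, Finset.mul_sum, Finset.mul_sum,
    ← Finset.sum_add_distrib]
  rfl

lemma planSet_nonempty [∀ t, Fintype (A t)] [∀ t, Nonempty (A t)] :
    (planSet past info act).Nonempty := by
  obtain ⟨s, hs, -⟩ := exists_plan_of_behavior past info act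
    fun t _ => PMF.pure (Classical.arbitrary (A t))
  exact ⟨s, hs⟩

lemma planWeight_le_one [∀ t, Fintype (A t)] {s : ∀ t, K t → A t → ℝ}
    (hs : s ∈ planSet past info act) (t : ℕ) (q : R t) : planWeight info act s t q ≤ 1 := by
  induction t with
  | zero => exact le_rfl
  | succ t ih =>
    refine le_trans ?_ ((hs.2 t (info t q)).le.trans (ih _))
    exact Finset.single_le_sum (f := fun u => s t (info t q) u) (fun u _ => hs.1 _ _ u)
      (Finset.mem_univ _)

lemma isCompact_planSet [∀ t, Fintype (A t)] : IsCompact (planSet past info act) := by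
  -- The product over all stages is infinite, but the box `[0, 1]` is compact in the product
  -- topology.
  refine (isCompact_Icc (a := (0 : ∀ t, K t → A t → ℝ)) (b := 1)).of_isClosed_subset ?_ ?_
  · simp only [planSet, Set.ofPred_and, Set.ofPred_forall]
    refine IsClosed.inter ?_ ?_
    · refine isClosed_iInter fun t => isClosed_iInter fun k => isClosed_iInter fun u =>
        isClosed_le continuous_const (by fun_prop)
    · exact isClosed_iInter fun t => isClosed_iInter fun k =>
        isClosed_eq (by fun_prop) (continuous_planWeight info act t _)
  · intro s hs
    refine ⟨fun t k u => hs.1 t k u, fun t k u => ?_⟩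
    exact (Finset.single_le_sum (f := fun u => s t k u) (fun u _ => hs.1 t k u)
      (Finset.mem_univ u)).trans ((hs.2 t k).le.trans (planWeight_le_one past info act hs _ _))

end RealizationPlan

/-- Point masses of a record that is drawn in four steps. -/
lemma PMF.bind_bind_bind_bind_pure_apply {P X Y U V : Type*} (q : PMF P) (r : P → PMF (X × Y))
    (a : P → X × Y → PMF U) (b : P → X × Y → PMF V) (p : P) (x : X) (y : Y) (u : U) (v : V) :
    (q.bind fun p => (r p).bind fun s => (a p s).bind fun u => (b p s).bind fun v =>
      PMF.pure (p, s.1, s.2, u, v)) (p, x, y, u, v) =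
      q p * (r p (x, y) * (a p (x, y) u * b p (x, y) v)) := by
  rw [PMF.bind_apply, tsum_eq_single p, PMF.bind_apply, tsum_eq_single (x, y),
    PMF.bind_apply, tsum_eq_single u, PMF.bind_apply, tsum_eq_single v, PMF.pure_apply_self,
    mul_one]
  · intro b' hb
    rw [PMF.pure_apply_of_ne, mul_zero]
    intro h
    cases h
    exact hb rfl
  · intro b' hb
    rw [PMF.bind_apply, ENNReal.tsum_eq_zero.2, mul_zero]
    intro c
    rw [PMF.pure_apply_of_ne, mul_zero]
    intro h
    cases h
    exact hb rfl
  · intro b' hb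
    simp only [PMF.bind_apply]
    rw [ENNReal.tsum_eq_zero.2, mul_zero]
    intro c
    rw [ENNReal.tsum_eq_zero.2, mul_zero]
    intro d
    rw [PMF.pure_apply_of_ne, mul_zero]
    intro h
    cases h
    exact hb rfl
  · intro b' hb
    simp only [PMF.bind_apply]
    rw [ENNReal.tsum_eq_zero.2, mul_zero]
    intro c
    rw [ENNReal.tsum_eq_zero.2, mul_zero]
    intro d
    rw [ENNReal.tsum_eq_zero.2, mul_zero]
    intro e
    rw [PMF.pure_apply_of_ne, mul_zero]
    intro h
    cases h
    exact hb rfl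

-- Factorization of the law of play and bilinearity of the cost

namespace OneSidedGame

variable (G : OneSidedGame.{u})

/-- The probability that the moves of nature contribute to a record. -/
noncomputable def chance : ∀ t, G.Past t → ℝ
  | 0, _ => 1
  | t + 1, (p, x, y, _, _) => chance t p * (G.stateObs t p (x, y)).toReal

/-- The last information of player 1 in a record. -/
def lastInfo₁ (t : ℕ) (q : G.Past (t + 1)) : G.Info₁ t := (q.1, q.2.1, q.2.2.1)

/-- The last action of player 1 in a record. -/
def lastAct₁ (t : ℕ) (q : G.Past (t + 1)) : G.U₁ t := q.2.2.2.1

/-- The last information of player 2 in a record of player 2. -/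
def lastInfo₂ (t : ℕ) (q : G.Past₂ (t + 1)) : G.Info₂ t := (q.1, q.2.1)

/-- The last action of player 2 in a record of player 2. -/
def lastAct₂ (t : ℕ) (q : G.Past₂ (t + 1)) : G.U₂ t := q.2.2

/-- Contribution of a behavioral strategy of player 1 to the probability of a record. -/
noncomputable abbrev weight₁ (γ : ∀ t, G.Info₁ t → PMF (G.U₁ t)) (t : ℕ) (p : G.Past t) : ℝ :=
  behaviorWeight (fun _ i => i.1) G.lastInfo₁ G.lastAct₁ γ t p

/-- Contribution of a behavioral strategy of player 2 to the probability of a record. -/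
noncomputable abbrev weight₂ (γ : ∀ t, G.Info₂ t → PMF (G.U₂ t)) (t : ℕ) (p : G.Past₂ t) : ℝ :=
  behaviorWeight (fun _ i => i.1) G.lastInfo₂ G.lastAct₂ γ t p

lemma law_succ_apply (g₁ : G.Strategy₁) (g₂ : G.Strategy₂) (t : ℕ) (ht : t + 1 ≤ G.T)
    (p : G.Past t) (x : G.X t) (y : G.Y t) (u₁ : G.U₁ t) (u₂ : G.U₂ t) :
    G.law g₁ g₂ (t + 1) ht (p, x, y, u₁, u₂) =
      G.law g₁ g₂ t (Nat.le_of_succ_le ht) p * (G.stateObs t p (x, y) *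
        (g₁ ⟨t, ht⟩ (p, x, y) u₁ * g₂ ⟨t, ht⟩ (G.restrict t p, y) u₂)) :=
  PMF.bind_bind_bind_bind_pure_apply (G.law g₁ g₂ t (Nat.le_of_succ_le ht)) (G.stateObs t)
    (fun p s => g₁ ⟨t, ht⟩ (p, s.1, s.2)) (fun p s => g₂ ⟨t, ht⟩ (G.restrict t p, s.2)) p x y u₁ u₂

/-- The two actions at a stage are drawn independently given the record, so each stage multiplies
the probability by one factor from nature and one from each player. -/
lemma law_toReal (γ₁ : ∀ t, G.Info₁ t → PMF (G.U₁ t)) (γ₂ : ∀ t, G.Info₂ t → PMF (G.U₂ t))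
    (t : ℕ) (ht : t ≤ G.T) (p : G.Past t) :
    (G.law (fun t => γ₁ t) (fun t => γ₂ t) t ht p).toReal =
      G.chance t p * G.weight₁ γ₁ t p * G.weight₂ γ₂ t (G.restrict t p) := by
  induction t with
  | zero =>
    simp only [chance, weight₁, weight₂, behaviorWeight, mul_one]
    exact congrArg ENNReal.toReal (PMF.pure_apply_self PUnit.unit)
  | succ t ih =>
    obtain ⟨p, x, y, u₁, u₂⟩ := p
    rw [law_succ_apply]
    simp only [ENNReal.toReal_mul, ih]
    simp only [chance, weight₁, weight₂, behaviorWeight, lastInfo₁, lastAct₁, lastInfo₂, lastAct₂,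
      restrict]
    ring

/-- The expected total cost as a bilinear expression in the contributions of the players. -/
noncomputable def payoff (w₁ : G.Past G.T → ℝ) (w₂ : G.Past₂ G.T → ℝ) : ℝ :=
  ∑ p, G.chance G.T p * w₁ p * w₂ (G.restrict G.T p) * G.totalCost G.T p

lemma J_eq_payoff (γ₁ : ∀ t, G.Info₁ t → PMF (G.U₁ t)) (γ₂ : ∀ t, G.Info₂ t → PMF (G.U₂ t)) :
    G.J (fun t => γ₁ t) (fun t => γ₂ t) = G.payoff (G.weight₁ γ₁ G.T) (G.weight₂ γ₂ G.T) := by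
  simp only [J, payoff, law_toReal]

lemma payoff_convexComb_left (w w' : G.Past G.T → ℝ) (v : G.Past₂ G.T → ℝ) (a b : ℝ) :
    G.payoff (fun p => a * w p + b * w' p) v = a * G.payoff w v + b * G.payoff w' v := by
  simp only [payoff, Finset.mul_sum, ← Finset.sum_add_distrib]
  exact Finset.sum_congr rfl fun p _ => by ring

lemma payoff_convexComb_right (w : G.Past G.T → ℝ) (v v' : G.Past₂ G.T → ℝ) (a b : ℝ) :
    G.payoff w (fun p => a * v p + b * v' p) = a * G.payoff w v + b * G.payoff w v' := by
  simp only [payoff, Finset.mul_sum, ← Finset.sum_add_distrib]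
  exact Finset.sum_congr rfl fun p _ => by ring

/-- A strategy of finitely many stages extends to all stages. -/
lemma exists_extend {T : ℕ} {K A : ℕ → Type*} [∀ t, Nonempty (A t)]
    (g : ∀ t : Fin T, K t → PMF (A t)) :
    ∃ γ : ∀ t, K t → PMF (A t), (fun t : Fin T => γ t) = g := by
  -- The laws from stage `T` on never enter the cost; a point mass fills them in.
  refine ⟨fun t => if h : t < T then g ⟨t, h⟩ else fun _ => PMF.pure (Classical.arbitrary _), ?_⟩
  funext t
  simp

-- Saddle point and value

lemma exists_isNash : ∃ (g₁ : G.Strategy₁) (g₂ : G.Strategy₂), G.IsNash g₁ g₂ := by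
  obtain ⟨s₁, hs₁, s₂, hs₂, h⟩ := Sion.exists_isSaddlePointOn'
    (X := planSet (fun _ i => i.1) G.lastInfo₁ G.lastAct₁)
    (Y := planSet (fun _ i => i.1) G.lastInfo₂ G.lastAct₂)
    (f := fun s₁ s₂ => G.payoff (planWeight G.lastInfo₁ G.lastAct₁ s₁ G.T)
      (planWeight G.lastInfo₂ G.lastAct₂ s₂ G.T))
    (planSet_nonempty _ _ _) (isCompact_planSet _ _ _)
    (fun s₂ _ => Continuous.lowerSemicontinuous (continuous_finsetSum _ fun p _ =>
      ((continuous_const.mul (continuous_planWeight _ _ _ _)).mul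
        continuous_const).mul continuous_const) |>.lowerSemicontinuousOn _)
    (fun s₂ _ => ConvexOn.quasiconvexOn ⟨convex_planSet _ _ _, fun s _ s' _ a b _ _ hab => by
      beta_reduce
      rw [show planWeight G.lastInfo₁ G.lastAct₁ (a • s + b • s') G.T = _ from
        funext (planWeight_convexComb _ _ s s' hab G.T), payoff_convexComb_left]
      rfl⟩)
    (convex_planSet _ _ _) (isCompact_planSet _ _ _)
    (fun s₁ _ => Continuous.upperSemicontinuous (continuous_finsetSum _ fun p _ =>
      (continuous_const.mul (continuous_planWeight _ _ _ _)).mul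
        continuous_const) |>.upperSemicontinuousOn _)
    (fun s₁ _ => ConcaveOn.quasiconcaveOn ⟨convex_planSet _ _ _, fun s _ s' _ a b _ _ hab => by
      beta_reduce
      rw [show planWeight G.lastInfo₂ G.lastAct₂ (a • s + b • s') G.T = _ from
        funext (planWeight_convexComb _ _ s s' hab G.T), payoff_convexComb_right]
      rfl⟩)
    (convex_planSet _ _ _) (planSet_nonempty _ _ _)
  obtain ⟨γ₁, hγ₁⟩ := exists_behavior_of_plan _ _ _ hs₁
  obtain ⟨γ₂, hγ₂⟩ := exists_behavior_of_plan _ _ _ hs₂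
  refine ⟨fun t => γ₁ t, fun t => γ₂ t, fun g₂' => ?_, fun g₁' => ?_⟩
  · obtain ⟨γ, rfl⟩ := exists_extend g₂'
    obtain ⟨s, hs, hw⟩ := exists_plan_of_behavior (fun _ i => i.1) G.lastInfo₂ G.lastAct₂ γ
    -- The saddle property bounds the payoff at `(s₁, y)` by that at `(x, s₂)`; choosing `x = s₁`
    -- gives the inequality for deviations of player 2, and `y = s₂` below the one for player 1.
    have := h s₁ hs₁ s hs
    beta_reduce at this
    rwa [← hγ₁, ← hγ₂, hw, ← J_eq_payoff, ← J_eq_payoff] at this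
  · obtain ⟨γ, rfl⟩ := exists_extend g₁'
    obtain ⟨s, hs, hw⟩ := exists_plan_of_behavior (fun _ i => i.1) G.lastInfo₁ G.lastAct₁ γ
    have := h s hs s₂ hs₂
    beta_reduce at this
    rwa [← hγ₁, ← hγ₂, hw, ← J_eq_payoff, ← J_eq_payoff] at this

variable {G}

/-- Playing `g₁` guarantees the upper bound; answering every strategy with `g₂` gives the lower one.
-/
lemma IsNash.upperValue_eq {g₁ : G.Strategy₁} {g₂ : G.Strategy₂} (h : G.IsNash g₁ g₂) :
    G.upperValue = (G.J g₁ g₂ : EReal) :=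
  le_antisymm (iInf_le_of_le g₁ (iSup_le fun g => EReal.coe_le_coe_iff.2 (h.1 g)))
    (le_iInf fun g => le_iSup_of_le g₂ (EReal.coe_le_coe_iff.2 (h.2 g)))

lemma IsNash.lowerValue_eq {g₁ : G.Strategy₁} {g₂ : G.Strategy₂} (h : G.IsNash g₁ g₂) :
    G.lowerValue = (G.J g₁ g₂ : EReal) :=
  le_antisymm (iSup_le fun g => iInf_le_of_le g₁ (EReal.coe_le_coe_iff.2 (h.1 g)))
    (le_iSup_of_le g₂ (le_iInf fun g => EReal.coe_le_coe_iff.2 (h.2 g)))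

end OneSidedGame

theorem lemma5 (G : OneSidedGame.{u}) :
    ∃ (g₁ : G.Strategy₁) (g₂ : G.Strategy₂), G.IsNash g₁ g₂ ∧
      G.upperValue = (G.J g₁ g₂ : EReal) ∧ G.lowerValue = (G.J g₁ g₂ : EReal) := by
  obtain ⟨g₁, g₂, h⟩ := G.exists_isNash
  exact ⟨g₁, g₂, h, h.upperValue_eq, h.lowerValue_eq⟩
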